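/- Conventions. A directed tree is a finite directed graph obtained by orienting each edge of an undirected tree in exactly one direction; the degree of a vertex is the number of its incident (incoming and outgoing) edges. An upward-planar layered drawing of a directed graph maps the vertices to distinct points of the plane with integer $y$-coordinates and each edge to a Jordan arc from its tail to its head along which the $y$-coordinate strictly increases, such that no edge passes through a vertex other than its endpoints and no two edges intersect except at common endpoints. The span of an edge in such a drawing is the $y$-coordinate of its head minus the $y$-coordinate of its tail; the span of a drawing is the maximum span of its edges; the span of a directed graph that has an upward-planar layered drawing is the minimum span of all its upward-planar layered drawings. Theorem. For each integer $d>2$ there is a directed tree of maximum degree $d$ in which every directed path has length (number of edges) at most $1$, which has an upward-planar layered drawing, and whose span is at least $\lfloor d/2\rfloor+1$. -/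

import Mathlib

namespace Digraph

/-- A directed tree: an orientation of an undirected tree. Asymmetry says that there are no loops
and that every edge of the underlying graph carries exactly one direction. -/
def IsDirectedTree {V : Type*} (D : Digraph V) : Prop :=
  (∀ u v, D.Adj u v → ¬ D.Adj v u) ∧ D.toSimpleGraphInclusive.IsTree

/-- The degree of a vertex: the number of its outgoing plus the number of its incoming edges. -/
noncomputable def totalDegree {V : Type*} (D : Digraph V) (v : V) : ℕ :=
  {w | D.Adj v w}.ncard + {w | D.Adj w v}.ncard

/-- There is a directed path with `k` edges, visiting the pairwise distinct vertices
`p 0, …, p k`. -/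
def HasDirectedPath {V : Type*} (D : Digraph V) (k : ℕ) : Prop :=
  ∃ p : Fin (k + 1) → V, Function.Injective p ∧ ∀ i : Fin k, D.Adj (p i.castSucc) (p i.succ)

/-- An upward-planar layered drawing: vertices are distinct points of the plane with integer
`y`-coordinates, every edge is a curve from its tail to its head along which the `y`-coordinate
strictly increases (in particular a Jordan arc), no edge passes through a vertex other than
its endpoints, and two distinct edges meet only at common endpoints. -/
structure UpwardPlanarLayeredDrawing {V : Type*} (D : Digraph V) where
  x : V → ℝ
  y : V → ℤ
  vertices_injective : Function.Injective fun v => ((x v, (y v : ℝ)) : ℝ × ℝ)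
  arc : ∀ u v, D.Adj u v → Path ((x u, (y u : ℝ)) : ℝ × ℝ) (x v, (y v : ℝ))
  arc_strictMono : ∀ u v (h : D.Adj u v), StrictMono fun t => (arc u v h t).2
  arc_avoids_vertices : ∀ u v (h : D.Adj u v) t w,
    arc u v h t = (x w, (y w : ℝ)) → w = u ∨ w = v
  arc_inter_arc : ∀ u v (h : D.Adj u v) u' v' (h' : D.Adj u' v') s t, (u, v) ≠ (u', v') →
    arc u v h s = arc u' v' h' t →
    ∃ w, (w = u ∨ w = v) ∧ (w = u' ∨ w = v') ∧ arc u v h s = (x w, (y w : ℝ))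

/-- The span of a drawing: the maximum over all edges `(u, v)` of `y v - y u` (which is always
positive); it is `0` if there are no edges. -/
noncomputable def UpwardPlanarLayeredDrawing.span {V : Type*} {D : Digraph V}
    (Γ : D.UpwardPlanarLayeredDrawing) : ℕ∞ :=
  ⨆ (u : V) (v : V) (_ : D.Adj u v), ((Γ.y v - Γ.y u).toNat : ℕ∞)

/-- The span of a digraph: the minimum span of its upward-planar layered drawings
(`⊤` if there are none). -/
noncomputable def drawingSpan {V : Type*} (D : Digraph V) : ℕ∞ :=
  ⨅ Γ : D.UpwardPlanarLayeredDrawing, Γ.span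

end Digraph

/-! Lower bound. Put `s = d / 2`, suppose all edges have span at most `s`, and look far from the
root and the leaves of a complete tree of degree `d ≥ 2 * s` whose vertices are all sources or
sinks. If a source `v` had three out-neighbours of equal height, the middle one `b` would sit in the
wedge of the outer edges. By planarity its other edges cannot start at or below `v`, so they use
fewer heights; by pigeonhole three of them start at equal height, and the situation recurs upside
down with a smaller height difference, until no height is left (`not_three`). Hence each of the `s`
heights above a source carries exactly two neighbours (`exists_two`). Now take the two neighbours
`a`, `b` at height `s` above `v`. A neighbour `u` one level below `a` and its second neighbour `w`
on the level of `a` are forced into the wedge of `v a` and `v b`. But `w` needs a neighbour `s`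
levels down, on the level of `v`, which the wedge forbids (`false_of_tail`). Drawability. Subtrees
get nested intervals of abscissae, and the depths get levels closing in from outside, `0, h, 1, h -
1, …` (`NaryNode.layeredGraphs`). -/

namespace Digraph

/-! ### Drawings as families of functions of the height, and the lower bound -/

/-- Every edge of a source/sink orientation `A` of the graph `N` is drawn as the graph
`x = F u v t` of a continuous function of the height `t`; edges meet only at common endpoints,
and their span is at most `s`. -/
structure LayeredGraphs {V : Type*} (s : ℕ) (N A : V → V → Prop) (x : V → ℝ) (y : V → ℤ)
    (F : V → V → ℝ → ℝ) : Prop where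
  nbr_iff : ∀ u v, N u v ↔ A u v ∨ A v u
  alternating : ∀ u v w, A u v → ¬ A v w
  position_injective : ∀ u v, x u = x v → y u = y v → u = v
  lt : ∀ u v, A u v → y u < y v
  le : ∀ u v, A u v → y v ≤ y u + s
  cont : ∀ u v, A u v → ContinuousOn (F u v) (Set.Icc (y u : ℝ) (y v))
  tail_eq : ∀ u v, A u v → F u v (y u) = x u
  head_eq : ∀ u v, A u v → F u v (y v) = x v
  meet : ∀ u v u' v' t, A u v → A u' v' → (u, v) ≠ (u', v') →
    t ∈ Set.Icc (y u : ℝ) (y v) → t ∈ Set.Icc (y u' : ℝ) (y v') → F u v t = F u' v' t →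
    ∃ w, (w = u ∨ w = v) ∧ (w = u' ∨ w = v') ∧ t = y w

/-- All vertices at distance less than `r` from `v` have at least `d` neighbours. -/
def FullBall {V : Type*} (N : V → V → Prop) (d : ℕ) : ℕ → V → Prop
  | 0, _ => True
  | r + 1, v => d ≤ {w | N v w}.ncard ∧ ∀ w, N v w → FullBall N d r w

theorem exists_lt_lt_of_two_lt_card {V : Type*} {S : Finset V} (hS : 2 < S.card) {f : V → ℝ}
    (hf : Set.InjOn f S) : ∃ a ∈ S, ∃ b ∈ S, ∃ c ∈ S, f a < f b ∧ f b < f c := by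
  obtain ⟨a, ha, b, hb, c, hc, hab, hac, hbc⟩ := Finset.two_lt_card.1 hS
  have h1 : f a ≠ f b := fun h => hab (hf ha hb h)
  have h2 : f a ≠ f c := fun h => hac (hf ha hc h)
  have h3 : f b ≠ f c := fun h => hbc (hf hb hc h)
  rcases lt_or_gt_of_ne h1 with h1 | h1 <;> rcases lt_or_gt_of_ne h2 with h2 | h2 <;>
    rcases lt_or_gt_of_ne h3 with h3 | h3
  · exact ⟨a, ha, b, hb, c, hc, h1, h3⟩
  · exact ⟨a, ha, c, hc, b, hb, h2, h3⟩
  · linarith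
  · exact ⟨c, hc, a, ha, b, hb, h2, h1⟩
  · exact ⟨b, hb, a, ha, c, hc, h1, h2⟩
  · linarith
  · exact ⟨b, hb, c, hc, a, ha, h3, h2⟩
  · exact ⟨c, hc, b, hb, a, ha, h3, h1⟩

theorem lt_of_continuousOn_of_ne {f g : ℝ → ℝ} {p q : ℝ} (hf : ContinuousOn f (Set.uIcc p q))
    (hg : ContinuousOn g (Set.uIcc p q)) (hne : ∀ t ∈ Set.uIcc p q, f t ≠ g t)
    (hp : f p < g p) : f q < g q := by
  by_contra! h
  have := intermediate_value_uIcc (hg.sub hf)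
  obtain ⟨t, ht, h0⟩ := this (show (0 : ℝ) ∈ _ from Set.mem_uIcc.2 (Or.inr
    ⟨by simpa using h, by simpa using hp.le⟩))
  exact hne t ht (by simp only [Pi.sub_apply] at h0; linarith)

namespace LayeredGraphs

variable {V : Type*} {s : ℕ} {N A : V → V → Prop} {x : V → ℝ} {y : V → ℤ} {F : V → V → ℝ → ℝ}

/-- Reflection in a horizontal line swaps sources and sinks, so each fact about out-edges also
serves for in-edges. `N` is kept separate from `A` because it is unchanged here. -/
theorem flip (L : LayeredGraphs s N A x y F) :
    LayeredGraphs s N (fun u v => A v u) x (fun v => - y v) (fun u v t => F v u (-t)) where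
  nbr_iff u v := (L.nbr_iff u v).trans or_comm
  alternating u v w h h' := L.alternating _ _ _ h' h
  position_injective u v h h' := L.position_injective u v h (by simpa using h')
  lt u v h := by have := L.lt _ _ h; omega
  le u v h := by have := L.le _ _ h; omega
  cont u v h := by
    refine (L.cont _ _ h).comp continuous_neg.continuousOn fun t ht => ?_
    simp only [Int.cast_neg, Set.mem_Icc] at ht ⊢
    constructor <;> linarith [ht.1, ht.2]
  tail_eq u v h := by simpa using L.head_eq _ _ h
  head_eq u v h := by simpa using L.tail_eq _ _ h
  meet u v u' v' t h h' hne ht ht' heq := by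
    simp only [Int.cast_neg, Set.mem_Icc] at ht ht' ⊢
    obtain ⟨w, h1, h2, h3⟩ := L.meet v u v' u' (-t) h h' (by
      rintro h; simp only [Prod.mk.injEq] at h; exact hne (by rw [h.1, h.2]))
      ⟨by linarith [ht.2], by linarith [ht.1]⟩ ⟨by linarith [ht'.2], by linarith [ht'.1]⟩ heq
    exact ⟨w, h1.symm, h2.symm, by linarith⟩

/-- Edges without common endpoints keep their left-to-right order. -/
theorem lt_of_lt (L : LayeredGraphs s N A x y F) {u v u' v' : V} (h : A u v) (h' : A u' v')
    (hu : u ≠ u') (hv : v ≠ v') {p q : ℤ} (hp : y u ≤ p ∧ p ≤ y v) (hp' : y u' ≤ p ∧ p ≤ y v')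
    (hq : y u ≤ q ∧ q ≤ y v) (hq' : y u' ≤ q ∧ q ≤ y v') (hlt : F u v p < F u' v' p) :
    F u v q < F u' v' q := by
  have aux : ∀ a b : V, y a ≤ p ∧ p ≤ y b → y a ≤ q ∧ q ≤ y b →
      Set.uIcc (p : ℝ) q ⊆ Set.Icc (y a : ℝ) (y b) := by
    intro a b h1 h2
    apply Set.uIcc_subset_Icc <;> constructor <;> norm_cast <;> tauto
  refine lt_of_continuousOn_of_ne ((L.cont _ _ h).mono (aux _ _ hp hq))
    ((L.cont _ _ h').mono (aux _ _ hp' hq')) (fun t ht heq => ?_) hlt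
  obtain ⟨w, h1, h2, -⟩ := L.meet u v u' v' t h h' (by simp [hu]) (aux _ _ hp hq ht)
    (aux _ _ hp' hq' ht) heq
  rcases h1 with rfl | rfl <;> rcases h2 with rfl | rfl
  · exact hu rfl
  · exact L.alternating _ _ _ h' h
  · exact L.alternating _ _ _ h h'
  · exact hv rfl

/-- An edge ending in the wedge above `v` bounded by two edges cannot start at or below `v`. -/
theorem wedge (L : LayeredGraphs s N A x y F) {v a b z w : V} (ha : A v a) (hb : A v b)
    (hzw : A z w) (hzv : z ≠ v) (hwa : w ≠ a) (hwb : w ≠ b) (hvw : y v < y w) (hya : y w ≤ y a)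
    (hyb : y w ≤ y b) (h1 : F v a (y w) < x w) (h2 : x w < F v b (y w)) : y v < y z := by
  by_contra! hz
  rw [← L.head_eq _ _ hzw] at h1 h2
  -- Otherwise the edge `z w` reaches down to the height of `v`, strictly between two edges that
  -- both have abscissa `x v` there.
  have e1 := L.lt_of_lt ha hzw hzv.symm hwa.symm (p := y w) (q := y v) (by omega) (by omega)
    (by omega) (by omega) h1
  have e2 := L.lt_of_lt hzw hb hzv hwb (p := y w) (q := y v) (by omega) (by omega)
    (by omega) (by omega) h2
  rw [L.tail_eq _ _ ha] at e1
  rw [L.tail_eq _ _ hb] at e2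
  linarith

/-- Pigeonhole over `k` levels; vertices on one level have distinct abscissae and can be sorted. -/
theorem exists_three [Finite V] (L : LayeredGraphs s N A x y F) (S : Set V) (k : ℕ) (p : ℤ)
    (hS : ∀ z ∈ S, 1 ≤ y z - p ∧ y z - p ≤ k) (hcard : 2 * k < S.ncard) :
    ∃ a ∈ S, ∃ b ∈ S, ∃ c ∈ S, y b = y a ∧ y c = y a ∧ x a < x b ∧ x b < x c := by
  classical
  have hfin := S.toFinite
  obtain ⟨j, -, hj⟩ := Finset.exists_lt_card_fiber_of_mul_lt_card_of_maps_to
    (s := hfin.toFinset) (t := Finset.Icc (1 : ℤ) k) (f := fun z => y z - p) (n := 2)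
    (fun z hz => Finset.mem_Icc.2 (hS z (by simpa using hz)))
    (by rw [← Set.ncard_eq_toFinset_card S hfin]; simp; omega)
  obtain ⟨a, ha, b, hb, c, hc, hab, hbc⟩ := exists_lt_lt_of_two_lt_card hj (f := x) (by
    intro u hu v hv h
    simp only [Finset.coe_filter, Set.mem_ofPred_eq] at hu hv
    exact L.position_injective u v h (by omega))
  simp only [Finset.mem_filter, Set.Finite.mem_toFinset] at ha hb hc
  exact ⟨a, ha.1, b, hb.1, c, hc.1, by omega, by omega, hab, hbc⟩

theorem nbr_iff_of_tail (L : LayeredGraphs s N A x y F) {v a : V} (h : A v a) (w : V) :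
    N v w ↔ A v w :=
  (L.nbr_iff v w).trans ⟨fun h' => h'.resolve_right fun h' => L.alternating _ _ _ h' h, Or.inl⟩

theorem nbr_iff_of_head (L : LayeredGraphs s N A x y F) {v a : V} (h : A a v) (w : V) :
    N v w ↔ A w v :=
  L.flip.nbr_iff_of_tail h w

/-- The out-neighbours of a vertex do not include three of equal height. -/
theorem not_three [Finite V] {d : ℕ} (hd : 2 * s ≤ d) (k : ℕ) (hk : k ≤ s)
    {A : V → V → Prop} {y : V → ℤ} {F : V → V → ℝ → ℝ} (L : LayeredGraphs s N A x y F)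
    {v a b c : V} (ha : A v a) (hb : A v b) (hc : A v c) (hba : y b = y a) (hca : y c = y a)
    (hab : x a < x b) (hbc : x b < x c) (hle : y b ≤ y v + k) (hfull : FullBall N d k b) :
    False := by
  -- The orientation and the drawing must vary, as each step passes to the reflected drawing.
  induction k generalizing A y F v a b c with
  | zero => have := L.lt _ _ hb; omega
  | succ k ih =>
    have hwa : b ≠ a := by rintro rfl; exact lt_irrefl _ hab
    have hwc : b ≠ c := by rintro rfl; exact lt_irrefl _ hbc
    have hy : ∀ z, A z b → z ≠ v → y v < y z := fun z hz hzv =>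
      L.wedge ha hc hz hzv hwa hwc (L.lt _ _ hb) (by omega) (by omega)
        (by rwa [hba, L.head_eq _ _ ha]) (by rwa [hba, ← hca, L.head_eq _ _ hc])
    -- Besides `v`, at least `d - 1 ≥ 2 * (k + 1) - 1` neighbours remain, and they share the at most
    -- `k` heights strictly between `v` and `b`.
    have hcard : 2 * k < ({w | N b w} \ {v}).ncard := by
      have := Set.pred_ncard_le_ncard_sdiff_singleton {w | N b w} v
      have := hfull.1
      omega
    obtain ⟨a', ⟨ha', ha0⟩, b', ⟨hb', hb0⟩, c', ⟨hc', hc0⟩, h1, h2, h3, h4⟩ :=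
      L.flip.exists_three ({w | N b w} \ {v}) k (- y b) (by
        rintro z ⟨hz, hzv⟩
        have hz := (L.nbr_iff_of_head hb z).1 hz
        have := hy z hz hzv
        have := L.lt _ _ hz
        push_cast at hle
        constructor <;> omega) hcard
    have hA := (L.nbr_iff_of_head hb b').1 hb'
    refine ih (by omega) L.flip ((L.nbr_iff_of_head hb a').1 ha') hA
      ((L.nbr_iff_of_head hb c').1 hc') h1 h2 h3 h4 ?_ (hfull.2 _ hb')
    have := hy b' hA hb0
    push_cast at hle
    omega

theorem FullBall.mono {V : Type*} {N : V → V → Prop} {d r r' : ℕ} (h : r ≤ r') {v : V}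
    (hv : FullBall N d r' v) : FullBall N d r v := by
  induction r generalizing r' v with
  | zero => trivial
  | succ r ih =>
    obtain ⟨r', rfl⟩ : ∃ m, r' = m + 1 := ⟨r' - 1, by omega⟩
    exact ⟨hv.1, fun w hw => ih (by omega) (hv.2 w hw)⟩

/-- Each of the heights `1, …, s` above a source is taken by at least two neighbours. -/
theorem exists_two [Finite V] {d : ℕ} (hd : 2 * s ≤ d) (L : LayeredGraphs s N A x y F) {v w : V}
    (hvw : A v w) (hfull : FullBall N d (s + 1) v) {j : ℕ} (hj : 1 ≤ j) (hjs : j ≤ s) :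
    ∃ a b, A v a ∧ A v b ∧ y a = y v + j ∧ y b = y v + j ∧ x a < x b := by
  classical
  have hfin := {w | A v w}.toFinite
  have hN : {w | N v w} = {w | A v w} := Set.ext fun w => L.nbr_iff_of_tail hvw w
  have hmap : ∀ z ∈ hfin.toFinset, y z - y v ∈ Finset.Icc (1 : ℤ) s := by
    intro z hz
    have hz : A v z := by simpa using hz
    have := L.lt _ _ hz
    have := L.le _ _ hz
    rw [Finset.mem_Icc]; omega
  have hinj : ∀ i : ℤ, Set.InjOn x ({z ∈ hfin.toFinset | y z - y v = i} : Finset V) := by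
    intro i u hu v hv h
    simp only [Finset.coe_filter, Set.mem_ofPred_eq] at hu hv
    exact L.position_injective u v h (by omega)
  have htwo : ∀ i ∈ Finset.Icc (1 : ℤ) s, ({z ∈ hfin.toFinset | y z - y v = i}).card ≤ 2 := by
    intro i hi
    by_contra! h
    obtain ⟨a, ha, b, hb, c, hc, hab, hbc⟩ := exists_lt_lt_of_two_lt_card h (hinj i)
    simp only [Finset.mem_filter, Set.Finite.mem_toFinset, Set.mem_ofPred_eq] at ha hb hc
    rw [Finset.mem_Icc] at hi
    exact not_three hd s le_rfl L ha.1 hb.1 hc.1 (by omega) (by omega) hab hbc (by omega)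
      (hfull.2 _ ((L.nbr_iff_of_tail hvw b).2 hb.1))
  -- At most two neighbours on each of the `s` heights: one deficient height would leave fewer than
  -- `2 * s ≤ d` in total.
  have hcard : 1 < ({z ∈ hfin.toFinset | y z - y v = j}).card := by
    by_contra! h
    have hsum := Finset.card_eq_sum_card_fiberwise hmap
    have hjm : (j : ℤ) ∈ Finset.Icc (1 : ℤ) s := by rw [Finset.mem_Icc]; omega
    have hlt := Finset.sum_lt_sum htwo ⟨_, hjm, by omega⟩
    rw [← hsum, ← Set.ncard_eq_toFinset_card _ hfin, ← hN] at hlt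
    have := hfull.1
    simp at hlt
    omega
  obtain ⟨a, ha, b, hb, hab⟩ := Finset.one_lt_card.1 hcard
  have hne : x a ≠ x b := fun h => hab (hinj _ (by simpa using ha) (by simpa using hb) h)
  simp only [Finset.mem_filter, Set.Finite.mem_toFinset, Set.mem_ofPred_eq] at ha hb
  rcases lt_or_gt_of_ne hne with h | h
  · exact ⟨a, b, ha.1, hb.1, by omega, by omega, h⟩
  · exact ⟨b, a, hb.1, ha.1, by omega, by omega, h⟩

/-- The radius `s + 4` is spent along `v, a, u, w`: `exists_two` at `w`, three steps from `v`, still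
needs radius `s + 1`. The hypothesis `hN` excludes 4-cycles. -/
theorem false_of_tail [Finite V] {d : ℕ} (hd : 2 * s ≤ d) (hd2 : 2 < d)
    (L : LayeredGraphs s N A x y F)
    (hN : ∀ u v a b, u ≠ v → N u a → N u b → N v a → N v b → a = b) {v w : V}
    (hvw : A v w) (hfull : FullBall N d (s + 4) v) : False := by
  -- For `s ≤ 1` the inequality `d > 2` already yields three neighbours on one level. Having `s ≥ 2`
  -- puts `u` below strictly above `v`.
  have hs : 2 ≤ s := by
    by_contra! hs
    obtain ⟨a, ha, b, hb, c, hc, h1, h2, h3, h4⟩ :=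
      L.exists_three {w | N v w} s (y v) (fun z hz => by
        have hz := (L.nbr_iff_of_tail hvw z).1 hz
        have := L.lt _ _ hz
        have := L.le _ _ hz
        omega) (by have := hfull.1; omega)
    have hbA := (L.nbr_iff_of_tail hvw b).1 hb
    refine not_three hd s le_rfl L ((L.nbr_iff_of_tail hvw a).1 ha) hbA
      ((L.nbr_iff_of_tail hvw c).1 hc) h1 h2 h3 h4 (L.le _ _ hbA)
      (FullBall.mono (by omega) (hfull.2 _ hb))
  obtain ⟨a, b, ha, hb, hya, hyb, hxab⟩ := L.exists_two hd hvw
    (FullBall.mono (by omega) hfull) (j := s) (by omega) le_rfl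
  have hab : a ≠ b := by rintro rfl; exact lt_irrefl _ hxab
  have hfa : FullBall N d (s + 3) a := hfull.2 _ ((L.nbr_iff_of_tail hvw a).2 ha)
  -- `u` is the right one of the two neighbours one level below `a`; `u'` serves only to bound a
  -- wedge on its left.
  obtain ⟨u', u, hu', hu, hyu', hyu, hxu⟩ := L.flip.exists_two hd ha
    (FullBall.mono (by omega) hfa) (j := 1) le_rfl (by omega)
  have huv : u ≠ v := by rintro rfl; omega
  have hfu : FullBall N d (s + 2) u := hfa.2 _ ((L.nbr_iff_of_head ha u).2 hu)
  obtain ⟨w, hw, hwa, hyw⟩ : ∃ w, A u w ∧ w ≠ a ∧ y w = y a := by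
    obtain ⟨w₁, w₂, h1, h2, h3, h4, h5⟩ := L.exists_two hd hu
      (FullBall.mono (by omega) hfu) (j := 1) le_rfl (by omega)
    by_cases h : w₁ = a
    · refine ⟨w₂, h2, ?_, by omega⟩
      rintro rfl
      exact absurd h5 (by rw [h]; exact lt_irrefl _)
    · exact ⟨w₁, h1, h, by omega⟩
  -- Otherwise `v, a, u, b` form a 4-cycle.
  have hwb : w ≠ b := by
    rintro rfl
    exact hab (hN v u a w huv.symm ((L.nbr_iff _ _).2 (Or.inl ha)) ((L.nbr_iff _ _).2 (Or.inl hb))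
      ((L.nbr_iff _ _).2 (Or.inl hu)) ((L.nbr_iff _ _).2 (Or.inl hw)))
  have hub : F u a (y u) < F v b (y u) := by
    refine L.lt_of_lt hu hb huv hab (p := y a) (by omega) (by omega) (by omega) (by omega) ?_
    rw [L.head_eq _ _ hu, hya, ← hyb, L.head_eq _ _ hb]
    exact hxab
  rw [L.tail_eq _ _ hu] at hub
  -- If `v a` passed to the right of `u`, then `u` would lie in the wedge below `a` between `u' a`
  -- and `v a`, and the edge `u w` could not reach the level of `a`.
  have hau : F v a (y u) < x u := by
    refine lt_of_le_of_ne (not_lt.1 fun hlt => ?_) fun heq => ?_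
    · have := L.flip.wedge hu' ha hw hwa (by rintro rfl; exact lt_irrefl _ hxu) huv
        (by omega) (by omega) (by omega) (by
          have : y u = y u' := by omega
          simp only [Int.cast_neg, neg_neg, this, L.tail_eq _ _ hu', hxu])
        (by simpa using hlt)
      omega
    · obtain ⟨z, hz1, hz2, hz⟩ := L.meet v a u a (y u) ha hu (by simp [huv.symm])
        ⟨by norm_cast; omega, by norm_cast; omega⟩ ⟨le_rfl, by norm_cast; omega⟩
        (heq.trans (L.tail_eq _ _ hu).symm)
      have hz : y u = y z := by exact_mod_cast hz
      rcases hz1 with rfl | rfl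
      · omega
      · omega
  rw [← L.tail_eq _ _ hw] at hau hub
  -- The edge `u w` starts between `v a` and `v b` and shares no endpoint with either, so `w` ends
  -- between them too.
  have h1 := L.lt_of_lt ha hw huv.symm hwa.symm (p := y u) (q := y w) (by omega) (by omega)
    (by omega) (by omega) hau
  have h2 := L.lt_of_lt hw hb huv hwb (p := y u) (q := y w) (by omega) (by omega)
    (by omega) (by omega) hub
  rw [L.head_eq _ _ hw] at h1 h2
  -- `z` is a neighbour of `w` exactly on the level of `v`; it differs from `v`, since otherwise `v,
  -- a, u, w` is a 4-cycle.
  obtain ⟨z, -, hz, -, hyz, -, -⟩ := L.flip.exists_two hd hw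
    (hfu.2 _ ((L.nbr_iff _ _).2 (Or.inl hw))) (j := s) (by omega) le_rfl
  have hzv : z ≠ v := by
    rintro rfl
    exact hwa (hN z u w a huv.symm ((L.nbr_iff _ _).2 (Or.inl hz))
      ((L.nbr_iff _ _).2 (Or.inl ha)) ((L.nbr_iff _ _).2 (Or.inl hw))
      ((L.nbr_iff _ _).2 (Or.inl hu)))
  have := L.wedge ha hb hz hzv hwa hwb (by omega) (by omega) (by omega) h1 h2
  omega

/-- There are no such drawings of span `s ≤ d / 2` if all vertices near `v` have degree
at least `d`. -/
theorem false_of_fullBall [Finite V] {d : ℕ} (hd : 2 * s ≤ d) (hd2 : 2 < d)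
    (L : LayeredGraphs s N A x y F)
    (hN : ∀ u v a b, u ≠ v → N u a → N u b → N v a → N v b → a = b) {v : V}
    (hfull : FullBall N d (s + 4) v) : False := by
  obtain ⟨w, hw⟩ : {w | N v w}.Nonempty := by
    rw [Set.nonempty_iff_ne_empty]
    intro h
    have := hfull.1
    rw [h, Set.ncard_empty] at this
    omega
  rcases (L.nbr_iff v w).1 hw with h | h
  · exact L.false_of_tail hd hd2 hN h hfull
  · exact L.flip.false_of_tail hd hd2 hN h hfull

end LayeredGraphs
end Digraph
-- Passing between drawings by arcs and functions of the height
namespace Digraph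

/-- A curve whose second coordinate is strictly increasing is the graph of a continuous function
of that coordinate. -/
theorem exists_graph_of_strictMono_snd {p q : ℝ × ℝ} (γ : Path p q)
    (hγ : StrictMono fun t => (γ t).2) :
    ∃ f : ℝ → ℝ, ContinuousOn f (Set.Icc p.2 q.2) ∧ f p.2 = p.1 ∧ f q.2 = q.1 ∧
      ∀ r ∈ Set.Icc p.2 q.2, ∃ t, γ t = (f r, r) := by
  set e : unitInterval → ℝ := fun t => (γ t).2 with he
  have hc : Continuous e := continuous_snd.comp γ.continuous
  -- Compactness of the unit interval makes the inverse of the height function continuous.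
  have hemb := (hc.isClosedEmbedding hγ.injective).isEmbedding
  have hinv : ∀ t, Function.invFun e (e t) = t := Function.leftInverse_invFun hγ.injective
  have hrange : Set.Icc p.2 q.2 ⊆ Set.range e := by
    have := intermediate_value_univ (0 : unitInterval) 1 hc
    simpa [he] using this
  have hcont : ContinuousOn (Function.invFun e) (Set.range e) := by
    rw [continuousOn_iff_continuous_domRestrict]
    convert hemb.toHomeomorph.symm.continuous using 1
    ext ⟨_, t, rfl⟩
    simp only [Set.domRestrict_apply, hinv]
    congr 1
    exact (hemb.toHomeomorph.symm_apply_apply t).symm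
  have h0 : Function.invFun e p.2 = 0 := by simpa [he] using hinv 0
  have h1 : Function.invFun e q.2 = 1 := by simpa [he] using hinv 1
  refine ⟨fun r => (γ (Function.invFun e r)).1, ?_, by simp [h0], by simp [h1], fun r hr => ?_⟩
  · exact ((continuous_fst.comp γ.continuous).comp_continuousOn hcont).mono hrange
  · obtain ⟨t, rfl⟩ := hrange hr
    exact ⟨t, by simp only [hinv]; rfl⟩

variable {V : Type*} {D : Digraph V}

theorem UpwardPlanarLayeredDrawing.exists_layeredGraphs (Γ : D.UpwardPlanarLayeredDrawing)
    (halt : ∀ u v w, D.Adj u v → ¬ D.Adj v w) {s : ℕ} (hs : Γ.span < (s + 1 : ℕ)) :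
    ∃ F, LayeredGraphs s (fun u v => D.Adj u v ∨ D.Adj v u) D.Adj Γ.x Γ.y F := by
  have hex : ∀ u v, ∃ f : ℝ → ℝ, D.Adj u v →
      ContinuousOn f (Set.Icc (Γ.y u : ℝ) (Γ.y v)) ∧ f (Γ.y u) = Γ.x u ∧ f (Γ.y v) = Γ.x v ∧
      ∀ h : D.Adj u v, ∀ r ∈ Set.Icc (Γ.y u : ℝ) (Γ.y v), ∃ t, Γ.arc u v h t = (f r, r) := by
    intro u v
    by_cases h : D.Adj u v
    · obtain ⟨f, h1, h2, h3, h4⟩ := exists_graph_of_strictMono_snd _ (Γ.arc_strictMono u v h)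
      exact ⟨f, fun _ => ⟨h1, h2, h3, fun _ => h4⟩⟩
    · exact ⟨0, fun h' => absurd h' h⟩
  choose F hF using hex
  refine ⟨F, ⟨fun u v => Iff.rfl, halt, ?_, ?_, ?_, fun u v h => (hF u v h).1,
    fun u v h => (hF u v h).2.1, fun u v h => (hF u v h).2.2.1, ?_⟩⟩
  · intro u v hx hy
    exact Γ.vertices_injective (by simp [hx, hy])
  · intro u v h
    have := Γ.arc_strictMono u v h (show (0 : unitInterval) < 1 from zero_lt_one)
    simpa using this
  · intro u v h
    have h1 : ((Γ.y v - Γ.y u).toNat : ℕ∞) ≤ Γ.span :=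
      le_iSup₂_of_le u v (le_iSup_of_le h le_rfl)
    have h2 : (Γ.y v - Γ.y u).toNat < s + 1 := by exact_mod_cast h1.trans_lt hs
    omega
  · intro u v u' v' r h h' hne hr hr' heq
    obtain ⟨t, ht⟩ := (hF u v h).2.2.2 h r hr
    obtain ⟨t', ht'⟩ := (hF u' v' h').2.2.2 h' r hr'
    obtain ⟨w, h1, h2, h3⟩ := Γ.arc_inter_arc u v h u' v' h' t t' hne (by rw [ht, ht', heq])
    refine ⟨w, h1, h2, ?_⟩
    rw [ht, Prod.mk.injEq] at h3
    exact h3.2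

/-- Edges are parametrised by affine height. By `hcov` every vertex lies on an edge, so an edge
through a foreign vertex would be a forbidden meeting of two edges. -/
theorem LayeredGraphs.nonempty_drawing {s : ℕ} {x : V → ℝ} {y : V → ℤ} {F : V → V → ℝ → ℝ}
    (L : LayeredGraphs s (fun u v => D.Adj u v ∨ D.Adj v u) D.Adj x y F)
    (hcov : ∀ u, ∃ v, D.Adj u v ∨ D.Adj v u) : Nonempty D.UpwardPlanarLayeredDrawing := by
  have hlt : ∀ u v, D.Adj u v → (0 : ℝ) < y v - y u := fun u v h => by
    have : (y u : ℝ) < y v := by exact_mod_cast L.lt u v h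
    linarith
  have hmem : ∀ u v, D.Adj u v → ∀ t : unitInterval,
      (y u : ℝ) + t * (y v - y u) ∈ Set.Icc (y u : ℝ) (y v) := fun u v h t => by
    have := hlt u v h
    constructor <;> nlinarith [t.2.1, t.2.2]
  have hfst : ∀ u v, D.Adj u v → ∀ w, w = u ∨ w = v → F u v (y w) = x w := by
    rintro u v h w (rfl | rfl)
    · exact L.tail_eq _ _ h
    · exact L.head_eq _ _ h
  let arc : ∀ u v, D.Adj u v → Path ((x u, (y u : ℝ)) : ℝ × ℝ) (x v, (y v : ℝ)) := fun u v h =>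
    { toFun := fun t => (F u v (y u + t * (y v - y u)), y u + t * (y v - y u))
      continuous_toFun := by
        refine Continuous.prodMk ?_ (by fun_prop)
        exact (L.cont u v h).comp_continuous (by fun_prop) (hmem u v h)
      source' := by simp [L.tail_eq u v h]
      target' := by simp [L.head_eq u v h] }
  have hinter : ∀ u v (h : D.Adj u v) u' v' (h' : D.Adj u' v') s t, (u, v) ≠ (u', v') →
      arc u v h s = arc u' v' h' t →
      ∃ w, (w = u ∨ w = v) ∧ (w = u' ∨ w = v') ∧ arc u v h s = (x w, (y w : ℝ)) := by
    intro u v h u' v' h' t t' hne heq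
    have heq' : ((F u v (y u + t * (y v - y u)), (y u + t * (y v - y u) : ℝ)) : ℝ × ℝ) =
        (F u' v' (y u' + t' * (y v' - y u')), (y u' + t' * (y v' - y u') : ℝ)) := heq
    rw [Prod.mk.injEq] at heq'
    obtain ⟨w, h1, h2, h3⟩ := L.meet u v u' v' (y u + t * (y v - y u)) h h' hne (hmem u v h t)
      (heq'.2 ▸ hmem u' v' h' t') (by rw [heq'.1, heq'.2])
    refine ⟨w, h1, h2, ?_⟩
    change ((F u v (y u + t * (y v - y u)), (y u + t * (y v - y u) : ℝ)) : ℝ × ℝ) = _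
    rw [h3, hfst u v h w h1]
  have hpos : ∀ u v, ((x u, (y u : ℝ)) : ℝ × ℝ) = (x v, (y v : ℝ)) → u = v := by
    intro u v h
    rw [Prod.mk.injEq] at h
    exact L.position_injective u v h.1 (by exact_mod_cast h.2)
  refine ⟨⟨x, y, hpos, arc, ?_, ?_, hinter⟩⟩
  · intro u v h t t' htt
    have h1 : (t : ℝ) < t' := htt
    change (y u : ℝ) + t * (y v - y u) < y u + t' * (y v - y u)
    have := mul_lt_mul_of_pos_right h1 (hlt u v h)
    linarith
  · intro u v h t w heq
    obtain ⟨w', hw'⟩ := hcov w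
    obtain ⟨p, q, hpq, hw, t', ht'⟩ : ∃ p q, ∃ hpq : D.Adj p q, (w = p ∨ w = q) ∧
        ∃ t', arc p q hpq t' = (x w, (y w : ℝ)) := by
      rcases hw' with h' | h'
      · exact ⟨w, w', h', Or.inl rfl, 0, (arc w w' h').source⟩
      · exact ⟨w', w, h', Or.inr rfl, 1, (arc w' w h').target⟩
    by_cases hne : (u, v) = (p, q)
    · rw [Prod.mk.injEq] at hne
      rwa [hne.1, hne.2]
    · obtain ⟨z, h1, -, h3⟩ := hinter u v h p q hpq t t' hne (heq.trans ht'.symm)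
      rw [hpos w z (heq.symm.trans h3)]
      exact h1

end Digraph

/-! ### Coordinates for a planar drawing of the `n`-ary tree -/

section NestedIntervals

theorem ratio_int_eq_of_abs_sub_lt {B r r' : ℝ} (hB : 0 < B) (h : ∃ m : ℤ, r = m / B)
    (h' : ∃ m : ℤ, r' = m / B) (hlt : |r - r'| < 1 / B) : r = r' := by
  obtain ⟨m, rfl⟩ := h
  obtain ⟨m', rfl⟩ := h'
  rw [← sub_div, abs_div, abs_of_pos hB, div_lt_div_iff_of_pos_right hB] at hlt
  have : |m - m'| < 1 := by exact_mod_cast hlt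
  rw [Int.abs_lt_one_iff, sub_eq_zero] at this
  rw [this]

variable {n : ℕ}

/-- The abscissa of a node of the `n`-ary tree: the value of its digit sequence in base `n + 1`. -/
noncomputable def listX : List (Fin n) → ℝ
  | [] => 0
  | a :: l => listX l + (a + 1) / (n + 1) ^ (l.length + 1)

theorem digit_div_pos (a : Fin n) (k : ℕ) : (0 : ℝ) < (a + 1) / (n + 1) ^ k := by positivity

theorem digit_div_lt (a : Fin n) (k : ℕ) :
    ((a : ℝ) + 1) / (n + 1) ^ (k + 1) < 1 / (n + 1) ^ k := by
  have ha : (a : ℝ) < n := by exact_mod_cast a.2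
  rw [pow_succ, div_lt_div_iff₀ (by positivity) (by positivity)]
  have : (0 : ℝ) < (n + 1) ^ k := by positivity
  nlinarith

theorem listX_eq_ratio_int (l : List (Fin n)) {k : ℕ} (hk : l.length ≤ k) :
    ∃ m : ℤ, listX l = m / ((n : ℝ) + 1) ^ k := by
  induction l with
  | nil => exact ⟨0, by simp [listX]⟩
  | cons a l ih =>
    simp only [List.length_cons] at hk
    obtain ⟨m, hm⟩ := ih (by omega)
    obtain ⟨e, rfl⟩ := Nat.exists_eq_add_of_le hk
    refine ⟨m + (a + 1) * (n + 1) ^ e, ?_⟩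
    rw [listX, hm]
    push_cast
    rw [pow_add _ _ e]
    field_simp

/-- The digits `a + 1` are never zero, so a longer list lies strictly between consecutive multiples
of the power of `1 / (n + 1)` belonging to its tail, and cannot coincide with a shorter list. -/
theorem listX_injective : Function.Injective (listX (n := n)) := by
  have hpos : ∀ k : ℕ, (0 : ℝ) < ((n : ℝ) + 1) ^ k := fun k => by positivity
  have aux : ∀ (l l' : List (Fin n)), l.length < l'.length → listX l ≠ listX l' := by
    rintro l (_ | ⟨a, m⟩) hlen heq
    · simp at hlen
    simp only [List.length_cons] at hlen
    have h1 := digit_div_pos a (m.length + 1)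
    have h2 := digit_div_lt a m.length
    rw [listX] at heq
    have := ratio_int_eq_of_abs_sub_lt (hpos m.length) (listX_eq_ratio_int l (by omega))
      (listX_eq_ratio_int m le_rfl) (by rw [heq, add_sub_cancel_left, abs_of_pos h1]; exact h2)
    linarith
  have aux' : ∀ (l l' : List (Fin n)), l.length = l'.length → listX l = listX l' → l = l' := by
    intro l
    induction l with
    | nil => intro l' h _; exact (List.eq_nil_of_length_eq_zero h.symm).symm
    | cons a l ih =>
      rintro (_ | ⟨a', l'⟩) hlen heq
      · simp at hlen
      simp only [List.length_cons, Nat.add_right_cancel_iff] at hlen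
      have h1 := digit_div_pos a (l.length + 1)
      have h2 := digit_div_lt a l.length
      have h3 := digit_div_pos a' (l.length + 1)
      have h4 := digit_div_lt a' l.length
      rw [listX, listX, ← hlen] at heq
      have h := ratio_int_eq_of_abs_sub_lt (hpos l.length) (listX_eq_ratio_int l le_rfl)
        (listX_eq_ratio_int l' hlen.ge) (by rw [abs_lt]; constructor <;> linarith)
      rw [h, add_right_inj, div_left_inj' (hpos _).ne', add_left_inj] at heq
      rw [ih l' hlen h, Fin.ext (Nat.cast_injective (R := ℝ) heq)]
  intro l l' h
  rcases lt_trichotomy l.length l'.length with h' | h' | h'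
  · exact absurd h (aux _ _ h')
  · exact aux' _ _ h' h
  · exact absurd h.symm (aux _ _ h')

/-- The level of the nodes of depth `j` in the tree of height `h`: `0, h, 1, h - 1, …`. -/
def levelY (h j : ℕ) : ℤ := if Even j then (j / 2 : ℕ) else (h : ℤ) - (j / 2 : ℕ)

/-- The lowest level of an edge from a node of depth `j` to its child. -/
def edgeLow (j : ℕ) : ℤ := ((j + 1) / 2 : ℕ)

/-- The highest level of an edge from a node of depth `j` to its child. -/
def edgeHigh (h j : ℕ) : ℤ := (h : ℤ) - (j / 2 : ℕ)

theorem levelY_of_even (h : ℕ) {j : ℕ} (hj : Even j) :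
    levelY h j = edgeLow j ∧ levelY h (j + 1) = edgeHigh h j := by
  have : ¬ Even (j + 1) := by simpa [Nat.even_add_one] using hj
  rw [levelY, levelY, if_pos hj, if_neg this, edgeLow, edgeHigh]
  rw [Nat.even_iff] at hj
  omega

theorem levelY_of_odd (h : ℕ) {j : ℕ} (hj : ¬ Even j) :
    levelY h j = edgeHigh h j ∧ levelY h (j + 1) = edgeLow j := by
  have : Even (j + 1) := by simpa [Nat.even_add_one] using hj
  rw [levelY, levelY, if_neg hj, if_pos this, edgeLow, edgeHigh]
  exact ⟨rfl, rfl⟩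

/-- Deeper edges live in a strictly narrower band of levels. Inside that band a shallower edge has
already become vertical. -/
theorem one_le_abs_sub_levelY {h j j' : ℕ} (hj : j < j') {t : ℝ}
    (ht : t ∈ Set.Icc (edgeLow j' : ℝ) (edgeHigh h j')) : 1 ≤ |t - levelY h j| := by
  by_cases he : Even j
  · have h1 : levelY h j + 1 ≤ edgeLow j' := by
      rw [levelY, if_pos he, edgeLow]; rw [Nat.even_iff] at he; omega
    have h1 : (levelY h j : ℝ) + 1 ≤ edgeLow j' := by exact_mod_cast h1
    exact le_abs.2 (Or.inl (by linarith [ht.1]))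
  · have h1 : edgeHigh h j' + 1 ≤ levelY h j := by
      rw [levelY, if_neg he, edgeHigh]; rw [Nat.even_iff] at he; omega
    have h1 : (edgeHigh h j' : ℝ) + 1 ≤ levelY h j := by exact_mod_cast h1
    exact le_abs.2 (Or.inr (by linarith [ht.2]))

/-- The edge from `l` to `a :: l`, as a function of the height `t`: it runs to the abscissa of
its child within one layer and is vertical from there on. -/
noncomputable def edgeX (h : ℕ) : List (Fin n) → ℝ → ℝ
  | [], _ => 0
  | a :: l, t => listX l + min 1 |t - levelY h l.length| * ((a + 1) / (n + 1) ^ (l.length + 1))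

theorem edgeX_parent (h : ℕ) (a : Fin n) (l : List (Fin n)) :
    edgeX h (a :: l) (levelY h l.length) = listX l := by
  simp [edgeX]

theorem edgeX_of_one_le {h : ℕ} {a : Fin n} {l : List (Fin n)} {t : ℝ}
    (ht : 1 ≤ |t - levelY h l.length|) : edgeX h (a :: l) t = listX (a :: l) := by
  rw [edgeX, min_eq_left ht, one_mul, listX]

/-- Edges below `l` stay in the half-open interval belonging to `l`; for distinct lists of one
length these intervals are disjoint. -/
theorem edgeX_mem (h : ℕ) (a : Fin n) (l : List (Fin n)) (t : ℝ) :
    listX l ≤ edgeX h (a :: l) t ∧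
      edgeX h (a :: l) t < listX l + 1 / (n + 1) ^ l.length := by
  have h1 := digit_div_pos a (l.length + 1)
  have h2 := digit_div_lt a l.length
  have h3 : 0 ≤ min 1 |t - levelY h l.length| := le_min zero_le_one (abs_nonneg _)
  have h4 : min 1 |t - levelY h l.length| ≤ 1 := min_le_left _ _
  rw [edgeX]
  constructor <;> nlinarith

theorem continuous_edgeX (h : ℕ) (l : List (Fin n)) : Continuous (edgeX h l) := by
  cases l with
  | nil => exact continuous_const
  | cons a l => unfold edgeX; fun_prop

theorem min_one_abs_eq_zero {r : ℝ} (h : min 1 |r| = 0) : r = 0 := by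
  rcases min_choice 1 |r| with h' | h' <;> rw [h'] at h
  · exact absurd h one_ne_zero
  · exact abs_eq_zero.1 h

/-- Two edges meet only at a common parent or at the child of one that is the parent of
the other. -/
theorem edgeX_meet {h : ℕ} {a a' : Fin n} {l l' : List (Fin n)} (hne : a :: l ≠ a' :: l')
    (hlen : l.length ≤ l'.length) {t : ℝ}
    (ht : t ∈ Set.Icc (edgeLow l'.length : ℝ) (edgeHigh h l'.length))
    (heq : edgeX h (a :: l) t = edgeX h (a' :: l') t) :
    (l = l' ∨ a :: l = l') ∧ t = levelY h l'.length := by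
  have hpos : (0 : ℝ) < ((n : ℝ) + 1) ^ l'.length := by positivity
  obtain ⟨h1, h2⟩ := edgeX_mem h a' l' t
  rcases hlen.lt_or_eq with hlt | hlen
  -- The shallower edge is vertical here, and its abscissa is a multiple of the interval length;
  -- inside the interval of `l'` only the left end `listX l'` is possible.
  · rw [edgeX_of_one_le (one_le_abs_sub_levelY hlt ht)] at heq
    have hX := ratio_int_eq_of_abs_sub_lt hpos (listX_eq_ratio_int (a :: l) hlt)
      (listX_eq_ratio_int l' le_rfl) (by rw [abs_lt]; constructor <;> linarith)
    refine ⟨Or.inr (listX_injective hX), ?_⟩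
    rw [hX, edgeX, left_eq_add, mul_eq_zero] at heq
    exact sub_eq_zero.1 (min_one_abs_eq_zero (heq.resolve_right (digit_div_pos _ _).ne'))
  · obtain ⟨h3, h4⟩ := edgeX_mem h a l t
    rw [hlen] at h4
    have hX := ratio_int_eq_of_abs_sub_lt hpos (listX_eq_ratio_int l hlen.le)
      (listX_eq_ratio_int l' le_rfl) (by rw [abs_lt]; constructor <;> linarith)
    obtain rfl := listX_injective hX
    refine ⟨Or.inl rfl, ?_⟩
    rw [edgeX, edgeX, add_right_inj, mul_eq_mul_left_iff] at heq
    rcases heq with heq | heq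
    · rw [div_left_inj' (by positivity), add_left_inj] at heq
      exact absurd (by rw [Fin.ext (Nat.cast_injective (R := ℝ) heq)]) hne
    · exact sub_eq_zero.1 (min_one_abs_eq_zero heq)

end NestedIntervals

/-! ### The alternately oriented complete `n`-ary tree -/

/-- The nodes of the complete `n`-ary tree of height `h`; the children of `l` are the
lists `a :: l`. -/
abbrev NaryNode (n h : ℕ) : Type := {l : List (Fin n) // l.length ≤ h}

namespace NaryNode

variable {n h : ℕ}

instance : Finite (NaryNode n h) := (List.finite_length_le (Fin n) h).to_subtype

/-- `v` is a child of `u`. -/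
def IsChild (u v : NaryNode n h) : Prop := ∃ a, v.1 = a :: u.1

theorem IsChild.length_eq {u v : NaryNode n h} (huv : IsChild u v) :
    v.1.length = u.1.length + 1 := by
  obtain ⟨a, ha⟩ := huv
  simp [ha]

theorem IsChild.unique {u u' v : NaryNode n h} (h1 : IsChild u v) (h2 : IsChild u' v) :
    u = u' := by
  obtain ⟨a, ha⟩ := h1
  obtain ⟨b, hb⟩ := h2
  rw [ha] at hb
  exact Subtype.ext (List.cons_eq_cons.1 hb).2

/-- The complete `n`-ary tree of height `h`, oriented from even to odd depths. -/
def digraph (n h : ℕ) : Digraph (NaryNode n h) where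
  Adj u v := Even u.1.length ∧ (IsChild u v ∨ IsChild v u)

theorem adj_alternating {u v : NaryNode n h} (huv : (digraph n h).Adj u v) :
    ¬ Even v.1.length := by
  obtain ⟨he, hc | hc⟩ := huv
  · rw [hc.length_eq, Nat.even_add_one]; exact not_not.2 he
  · rwa [hc.length_eq, Nat.even_add_one] at he

theorem nbr_iff (u v : NaryNode n h) :
    (digraph n h).Adj u v ∨ (digraph n h).Adj v u ↔ IsChild u v ∨ IsChild v u := by
  constructor
  · rintro (h | h)
    · exact h.2
    · exact h.2.symm
  · intro hc
    by_cases he : Even u.1.length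
    · exact Or.inl ⟨he, hc⟩
    · refine Or.inr ⟨?_, hc.symm⟩
      rcases hc with hc | hc
      · rw [hc.length_eq, Nat.even_add_one]; exact he
      · rwa [hc.length_eq, Nat.even_add_one, not_not] at he

theorem adj_simpleGraph_iff (u v : NaryNode n h) :
    (digraph n h).toSimpleGraphInclusive.Adj u v ↔ IsChild u v ∨ IsChild v u := by
  rw [Digraph.toSimpleGraphInclusive, SimpleGraph.fromRel_adj, nbr_iff]
  refine and_iff_right_of_imp ?_
  rintro (hc | hc) rfl <;> have := hc.length_eq <;> omega

theorem reachable_root (l : List (Fin n)) (hl : l.length ≤ h) :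
    (digraph n h).toSimpleGraphInclusive.Reachable ⟨l, hl⟩ ⟨[], Nat.zero_le h⟩ := by
  induction l with
  | nil => exact SimpleGraph.Reachable.refl _
  | cons a l ih =>
    have hl' : l.length ≤ h := (Nat.le_succ _).trans hl
    exact (SimpleGraph.Adj.reachable
      ((adj_simpleGraph_iff _ ⟨l, hl'⟩).2 (Or.inr ⟨a, rfl⟩))).trans (ih hl')

/-- A connected graph with at most one edge fewer than vertices is a tree; each edge joins a
non-root node to its parent. -/
theorem isDirectedTree (n h : ℕ) : (digraph n h).IsDirectedTree := by
  refine ⟨fun u v huv hvu => adj_alternating huv hvu.1, ?_⟩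
  have hconn : (digraph n h).toSimpleGraphInclusive.Connected :=
    { preconnected := fun u v => (reachable_root u.1 u.2).trans (reachable_root v.1 v.2).symm
      nonempty := ⟨⟨[], Nat.zero_le h⟩⟩ }
  rw [SimpleGraph.isTree_iff_connected_and_card]
  refine ⟨hconn, le_antisymm ?_ hconn.card_vert_le_card_edgeSet_add_one⟩
  let parent : NaryNode n h → NaryNode n h := fun u => ⟨u.1.tail, by simp; have := u.2; omega⟩
  have hsub : (digraph n h).toSimpleGraphInclusive.edgeSet ⊆
      (fun u => s(u, parent u)) '' ({⟨[], Nat.zero_le h⟩}ᶜ : Set (NaryNode n h)) := by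
    intro e he
    induction e using Sym2.ind with
    | _ u v =>
      rw [SimpleGraph.mem_edgeSet, adj_simpleGraph_iff] at he
      have aux : ∀ u v : NaryNode n h, IsChild u v →
          v ∈ ({⟨[], Nat.zero_le h⟩}ᶜ : Set (NaryNode n h)) ∧ parent v = u := by
        rintro ⟨u, hu⟩ ⟨v, hv⟩ ⟨a, rfl⟩
        simp [parent]
      rcases he with he | he
      · exact ⟨v, (aux _ _ he).1, by simp only [(aux _ _ he).2]; exact Sym2.eq_swap⟩
      · exact ⟨u, (aux _ _ he).1, by simp only [(aux _ _ he).2]⟩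
  have h1 := (Set.ncard_le_ncard hsub).trans (Set.ncard_image_le (Set.toFinite _))
  have h2 := Set.ncard_add_ncard_compl ({⟨[], Nat.zero_le h⟩} : Set (NaryNode n h))
  rw [Set.ncard_singleton] at h2
  rw [Nat.card_coe_set_eq]
  omega

theorem ncard_children {u : NaryNode n h} (hu : u.1.length < h) :
    {v | IsChild u v}.ncard = n := by
  have : {v | IsChild u v} = Set.range fun a : Fin n => (⟨a :: u.1, hu⟩ : NaryNode n h) := by
    ext v
    exact exists_congr fun a => ⟨fun hv => Subtype.ext hv.symm, fun hv => by rw [← hv]⟩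
  rw [this, ← Set.image_univ, Set.ncard_image_of_injective _ (fun a b hab => by simpa using hab),
    Set.ncard_univ, Nat.card_eq_fintype_card, Fintype.card_fin]

theorem ncard_children_le (u : NaryNode n h) : {v | IsChild u v}.ncard ≤ n := by
  rcases u.2.lt_or_eq with hu | hu
  · exact (ncard_children hu).le
  · have : {v | IsChild u v} = ∅ := by
      refine Set.eq_empty_of_forall_notMem fun v hv => ?_
      have h1 : v.1.length = _ := hv.length_eq
      have := v.2
      omega
    simp [this]

theorem ncard_parents_le (u : NaryNode n h) : {v | IsChild v u}.ncard ≤ 1 :=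
  (Set.ncard_le_one (Set.toFinite _)).2 fun _ h1 _ h2 => IsChild.unique h1 h2

theorem ncard_parents {u : NaryNode n h} (hu : 0 < u.1.length) :
    {v | IsChild v u}.ncard = 1 := by
  refine le_antisymm (ncard_parents_le u) ((Set.ncard_pos).2 ?_)
  obtain ⟨_ | ⟨a, l⟩, hl⟩ := u
  · simp at hu
  · exact ⟨⟨l, (Nat.le_succ _).trans hl⟩, a, rfl⟩

theorem ncard_nbrs (u : NaryNode n h) :
    {v | (digraph n h).Adj u v ∨ (digraph n h).Adj v u}.ncard =
      {v | IsChild u v}.ncard + {v | IsChild v u}.ncard := by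
  rw [← Set.ncard_union_eq]
  · congr 1
    ext v
    exact nbr_iff u v
  · refine Set.disjoint_left.2 fun v (hv : IsChild u v) (hv' : IsChild v u) => ?_
    have := hv.length_eq
    have := hv'.length_eq
    omega

theorem totalDegree_eq (u : NaryNode n h) :
    (digraph n h).totalDegree u = {v | IsChild u v}.ncard + {v | IsChild v u}.ncard := by
  rw [← ncard_nbrs, Digraph.totalDegree, ← Set.ncard_union_eq]
  · rfl
  · exact Set.disjoint_left.2 fun v hv hv' => adj_alternating hv hv'.1

theorem totalDegree_le (u : NaryNode n h) : (digraph n h).totalDegree u ≤ n + 1 := by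
  rw [totalDegree_eq]
  exact add_le_add (ncard_children_le u) (ncard_parents_le u)

theorem totalDegree_of_inner {u : NaryNode n h} (h0 : 0 < u.1.length) (hu : u.1.length < h) :
    (digraph n h).totalDegree u = n + 1 := by
  rw [totalDegree_eq, ncard_children hu, ncard_parents h0]

theorem hasDirectedPath_le (k : ℕ) (hk : (digraph n h).HasDirectedPath k) : k ≤ 1 := by
  obtain ⟨p, -, hp⟩ := hk
  by_contra! hk
  exact adj_alternating (hp ⟨0, by omega⟩) (hp ⟨1, by omega⟩).1

/-- The bounds on the depth keep the root and the leaves, the only nodes of smaller degree, out of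
the ball. -/
theorem fullBall (r : ℕ) (u : NaryNode n h) (h0 : r < u.1.length) (hr : u.1.length + r ≤ h) :
    Digraph.FullBall (fun u v => (digraph n h).Adj u v ∨ (digraph n h).Adj v u) (n + 1) r u := by
  induction r generalizing u with
  | zero => trivial
  | succ r ih =>
    refine ⟨?_, fun w hw => ?_⟩
    · rw [ncard_nbrs, ncard_children (by omega), ncard_parents (by omega)]
    · rcases (nbr_iff u w).1 hw with hw | hw <;> have := hw.length_eq <;> exact ih w (by omega) (by omega)

/-- Distinct nodes share no child, so each common neighbour is a parent of `u` or of `v`. Uniqueness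
of parents and comparison of depths do the rest. -/
theorem eq_of_common_nbrs {u v a b : NaryNode n h} (huv : u ≠ v)
    (hua : IsChild u a ∨ IsChild a u) (hub : IsChild u b ∨ IsChild b u)
    (hva : IsChild v a ∨ IsChild a v) (hvb : IsChild v b ∨ IsChild b v) : a = b := by
  rcases hua with h1 | h1 <;> rcases hva with h2 | h2
  · exact absurd (h1.unique h2) huv
  · rcases hub with h3 | h3
    · rcases hvb with h4 | h4
      · exact absurd (h3.unique h4) huv
      · exact h2.unique h4
    · rcases hvb with h4 | h4 <;> have := h1.length_eq <;> have := h2.length_eq <;>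
        have := h3.length_eq <;> have := h4.length_eq
      · omega
      · exact h2.unique h4
  · rcases hub with h3 | h3
    · rcases hvb with h4 | h4
      · exact absurd (h3.unique h4) huv
      · have := h1.length_eq
        have := h2.length_eq
        have := h3.length_eq
        have := h4.length_eq
        omega
    · exact h1.unique h3
  · rcases hub with h3 | h3
    · rcases hvb with h4 | h4
      · exact absurd (h3.unique h4) huv
      · exact h2.unique h4
    · exact h1.unique h3

/-- Describes an edge by its child `a :: l`, whichever end is the tail, so that the geometry of
`edgeX` applies to both orientations at once. -/
theorem exists_edge {u v : NaryNode n h} (huv : (digraph n h).Adj u v) :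
    ∃ a l, (u.1 = l ∧ v.1 = a :: l ∧ Even l.length ∨ v.1 = l ∧ u.1 = a :: l ∧ ¬ Even l.length) ∧
      (if u.1.length < v.1.length then edgeX h v.1 else edgeX h u.1) = edgeX h (a :: l) ∧
      levelY h u.1.length = edgeLow l.length ∧ levelY h v.1.length = edgeHigh h l.length ∧
      l.length < h := by
  obtain ⟨he, ⟨a, ha⟩ | ⟨a, ha⟩⟩ := huv
  · have hv := v.2
    rw [ha] at hv
    exact ⟨a, u.1, Or.inl ⟨rfl, ha, he⟩, by simp [ha], (levelY_of_even h he).1,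
      by rw [ha]; exact (levelY_of_even h he).2, hv⟩
  · have hu := u.2
    have ho : ¬ Even v.1.length := by
      rwa [ha, List.length_cons, Nat.even_add_one] at he
    rw [ha] at hu
    exact ⟨a, v.1, Or.inr ⟨rfl, ha, ho⟩, by simp [ha],
      by rw [ha]; exact (levelY_of_odd h ho).2, (levelY_of_odd h ho).1, hu⟩

theorem levelY_lt {u v : NaryNode n h} (huv : (digraph n h).Adj u v) :
    levelY h u.1.length < levelY h v.1.length := by
  obtain ⟨a, l, -, -, h1, h2, h3⟩ := exists_edge huv
  rw [h1, h2, edgeLow, edgeHigh]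
  omega

theorem layeredGraphs (n h : ℕ) :
    Digraph.LayeredGraphs h (fun u v => (digraph n h).Adj u v ∨ (digraph n h).Adj v u)
      (digraph n h).Adj (fun u => listX u.1) (fun u => levelY h u.1.length)
      (fun u v => if u.1.length < v.1.length then edgeX h v.1 else edgeX h u.1) := by
  have hparent : ∀ {u v : NaryNode n h}, IsChild u v → 1 ≤
      |(levelY h v.1.length : ℝ) - levelY h u.1.length| := by
    intro u v hc
    rw [← Int.cast_sub, ← Int.cast_abs]
    have hne : levelY h v.1.length ≠ levelY h u.1.length := by
      rcases (nbr_iff u v).2 (Or.inl hc) with hadj | hadj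
      · exact (levelY_lt hadj).ne'
      · exact (levelY_lt hadj).ne
    exact_mod_cast Int.one_le_abs (sub_ne_zero.2 hne)
  have hend : ∀ {u v : NaryNode n h}, IsChild u v →
      edgeX h v.1 (levelY h u.1.length) = listX u.1 ∧
        edgeX h v.1 (levelY h v.1.length) = listX v.1 := by
    intro u v hc
    have h1 := hparent hc
    obtain ⟨a, ha⟩ := hc
    rw [ha] at h1 ⊢
    exact ⟨edgeX_parent h a u.1, edgeX_of_one_le h1⟩
  refine ⟨fun _ _ => Iff.rfl, fun u v w h1 h2 => adj_alternating h1 h2.1, ?_,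
    fun u v huv => levelY_lt huv, ?_, ?_, ?_, ?_, ?_⟩
  · exact fun u v hx _ => Subtype.ext (listX_injective hx)
  · intro u v huv
    obtain ⟨a, l, -, -, h1, h2, h3⟩ := exists_edge huv
    rw [h1, h2, edgeLow, edgeHigh]
    omega
  · intro u v huv
    obtain ⟨a, l, -, h1, -⟩ := exists_edge huv
    rw [h1]
    exact (continuous_edgeX h _).continuousOn
  · rintro u v ⟨-, hc | hc⟩ <;> have := hc.length_eq
    · simpa [this] using (hend hc).1
    · simpa [this] using (hend hc).2
  · rintro u v ⟨-, hc | hc⟩ <;> have := hc.length_eq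
    · simpa [this] using (hend hc).2
    · simpa [this] using (hend hc).1
  · intro u v u' v' t huv huv' hne ht ht' heq
    obtain ⟨a, l, hl, h1, h2, h3, -⟩ := exists_edge huv
    obtain ⟨a', l', hl', h1', h2', h3', -⟩ := exists_edge huv'
    have hcons : a :: l ≠ a' :: l' := by
      intro hc
      obtain ⟨rfl, rfl⟩ := List.cons_eq_cons.1 hc
      apply hne
      rcases hl with ⟨e1, e2, e3⟩ | ⟨e1, e2, e3⟩ <;>
        rcases hl' with ⟨e1', e2', e3'⟩ | ⟨e1', e2', e3'⟩
      · rw [Subtype.ext (e1.trans e1'.symm), Subtype.ext (e2.trans e2'.symm)]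
      · exact absurd e3 e3'
      · exact absurd e3' e3
      · rw [Subtype.ext (e1.trans e1'.symm), Subtype.ext (e2.trans e2'.symm)]
    have hmem : ∀ {u v : NaryNode n h} {a : Fin n} {l : List (Fin n)},
        (u.1 = l ∧ v.1 = a :: l ∧ Even l.length ∨ v.1 = l ∧ u.1 = a :: l ∧ ¬ Even l.length) →
        ∀ w : NaryNode n h, (w.1 = l ∨ w.1 = a :: l) ↔ (w = u ∨ w = v) := by
      rintro u v a l (⟨e1, e2, -⟩ | ⟨e1, e2, -⟩) w <;>
        rw [← e2, ← e1, ← Subtype.ext_iff, ← Subtype.ext_iff]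
      exact or_comm
    have hnode : ∀ {u v : NaryNode n h} {a : Fin n} {l : List (Fin n)},
        (u.1 = l ∧ v.1 = a :: l ∧ Even l.length ∨ v.1 = l ∧ u.1 = a :: l ∧ ¬ Even l.length) →
        l.length ≤ h := by
      rintro u v a l (⟨rfl, -, -⟩ | ⟨rfl, -, -⟩)
      · exact u.2
      · exact v.2
    rw [h1, h1'] at heq
    rw [h2, h3] at ht
    rw [h2', h3'] at ht'
    simp only [← hmem hl, ← hmem hl']
    rcases le_total l.length l'.length with hle | hle
    · obtain ⟨e1, e2⟩ := edgeX_meet hcons hle ht' heq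
      exact ⟨⟨l', hnode hl'⟩, by simpa only [eq_comm] using e1, Or.inl rfl, e2⟩
    · obtain ⟨e1, e2⟩ := edgeX_meet hcons.symm hle ht heq.symm
      exact ⟨⟨l, hnode hl⟩, Or.inl rfl, by simpa only [eq_comm] using e1, e2⟩

end NaryNode

theorem mainTheorem9 (d : ℕ) (hd : 2 < d) :
    ∃ (V : Type) (_ : Finite V) (D : Digraph V),
      D.IsDirectedTree ∧
      IsGreatest (Set.range D.totalDegree) d ∧
      (∀ k : ℕ, D.HasDirectedPath k → k ≤ 1) ∧
      Nonempty D.UpwardPlanarLayeredDrawing ∧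
      ((d / 2 + 1 : ℕ) : ℕ∞) ≤ D.drawingSpan := by
  obtain ⟨n, rfl⟩ : ∃ n, d = n + 1 := ⟨d - 1, by omega⟩
  set s := (n + 1) / 2 with hs
  -- The vertex `v` at depth `s + 5` then has `s + 4` levels below it and more than `s + 4` above,
  -- as the ball of radius `s + 4` requires.
  set h := 2 * s + 9 with hh
  let v : NaryNode n h := ⟨List.replicate (s + 5) ⟨0, by omega⟩, by simp; omega⟩
  have hv : v.1.length = s + 5 := List.length_replicate
  refine ⟨NaryNode n h, inferInstance, NaryNode.digraph n h, NaryNode.isDirectedTree n h,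
    ⟨⟨v, NaryNode.totalDegree_of_inner (by omega) (by omega)⟩, ?_⟩,
    NaryNode.hasDirectedPath_le, ?_, ?_⟩
  · rintro _ ⟨u, rfl⟩
    exact NaryNode.totalDegree_le u
  · refine (NaryNode.layeredGraphs n h).nonempty_drawing fun u => ?_
    simp only [NaryNode.nbr_iff]
    obtain ⟨_ | ⟨a, l⟩, hl⟩ := u
    · exact ⟨⟨[⟨0, by omega⟩], by simp; omega⟩, Or.inl ⟨_, rfl⟩⟩
    · exact ⟨⟨l, (Nat.le_succ _).trans hl⟩, Or.inr ⟨a, rfl⟩⟩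
  · refine le_iInf fun Γ => not_lt.1 fun hlt => ?_
    obtain ⟨F, L⟩ := Γ.exists_layeredGraphs
      (fun u v w h1 h2 => NaryNode.adj_alternating h1 h2.1) hlt
    refine L.false_of_fullBall (d := n + 1) (by omega) hd ?_
      (NaryNode.fullBall (s + 4) v (by omega) (by omega))
    intro u v a b huv h1 h2 h3 h4
    rw [NaryNode.nbr_iff] at h1 h2 h3 h4
    exact NaryNode.eq_of_common_nbrs huv h1 h2 h3 h4
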